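/- Let $G$ be a mixed graph with vertices $1,\dots,t$, that is, a graph that may have undirected and directed edges (multiple edges and loops are allowed). A form representation $\mathcal A$ of $G$ of dimension $\underline n=(n_1,\dots,n_t)$ assigns to each vertex $i$ the vector space $\mathbb C^{n_i}$, to each undirected edge $\alpha$ between $i$ and $j$ ($i\le j$) a bilinear form $A_\alpha:\mathbb C^{n_i}\times\mathbb C^{n_j}\to\mathbb C$, and to each directed edge $\alpha$ from $i$ to $j$ a sesquilinear form $A_\alpha:\mathbb C^{n_i}\times\mathbb C^{n_j}\to\mathbb C$, linear in the first argument and conjugate linear in the second. Let $\mathcal A$ and $\mathcal B$ be form representations of $G$ of dimensions $\underline n$ and $\underline m$. They are called topologically isomorphic (respectively, linearly isomorphic) if there is a family of homeomorphisms (respectively, linear bijections) $\varphi_i:\mathbb C^{n_i}\to\mathbb C^{m_i}$, $i=1,\dots,t$, such that $A_\alpha(u,v)=B_\alpha(\varphi_i u,\varphi_j v)$ for every edge $\alpha$ between $i$ and $j$ ($i\le j$) or from $i$ to $j$ and for all $u\in\mathbb C^{n_i}$, $v\in\mathbb C^{n_j}$. Then $\mathcal A$ and $\mathcal B$ are topologically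 isomorphic if and only if they are linearly isomorphic. -/

import Mathlib

universe u v

/-- A mixed graph with vertices indexed by `Fin t`. Multiple edges and loops are allowed.
The endpoints of an undirected edge are listed in non-decreasing order. -/
structure MixedGraph (t : ℕ) where
  /-- the undirected edges -/
  UEdge : Type u
  /-- the directed edges -/
  DEdge : Type v
  /-- the smaller endpoint of an undirected edge -/
  ufst : UEdge → Fin t
  /-- the larger endpoint of an undirected edge -/
  usnd : UEdge → Fin t
  ufst_le_usnd : ∀ α : UEdge, ufst α ≤ usnd α
  /-- the tail of a directed edge -/
  dsrc : DEdge → Fin t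
  /-- the head of a directed edge -/
  dtgt : DEdge → Fin t

/-- A form representation of dimension `n` of a mixed graph: the space `ℂ^(n i)` at the vertex
`i`, a bilinear form for each undirected edge, and for each directed edge a sesquilinear form
that is linear in the first argument and conjugate linear in the second. -/
structure FormRep {t : ℕ} (G : MixedGraph.{u, v} t) (n : Fin t → ℕ) where
  bil : ∀ α : G.UEdge,
    (Fin (n (G.ufst α)) → ℂ) →ₗ[ℂ] (Fin (n (G.usnd α)) → ℂ) →ₗ[ℂ] ℂ
  sesq : ∀ β : G.DEdge,
    (Fin (n (G.dsrc β)) → ℂ) →ₗ[ℂ] (Fin (n (G.dtgt β)) → ℂ) →ₗ⋆[ℂ] ℂ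

namespace FormRep

variable {t : ℕ} {G : MixedGraph.{u, v} t} {n m : Fin t → ℕ}

/-- The family of maps `φ` transforms `A` to `B`. -/
def Transforms (A : FormRep G n) (B : FormRep G m)
    (φ : ∀ i : Fin t, (Fin (n i) → ℂ) → (Fin (m i) → ℂ)) : Prop :=
  (∀ (α : G.UEdge) (x : Fin (n (G.ufst α)) → ℂ) (y : Fin (n (G.usnd α)) → ℂ),
      A.bil α x y = B.bil α (φ (G.ufst α) x) (φ (G.usnd α) y)) ∧
  (∀ (β : G.DEdge) (x : Fin (n (G.dsrc β)) → ℂ) (y : Fin (n (G.dtgt β)) → ℂ),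
      A.sesq β x y = B.sesq β (φ (G.dsrc β) x) (φ (G.dtgt β) y))

/-- Some family of homeomorphisms transforms `A` to `B`. -/
def TopologicallyIsomorphic (A : FormRep G n) (B : FormRep G m) : Prop :=
  ∃ φ : ∀ i : Fin t, (Fin (n i) → ℂ) ≃ₜ (Fin (m i) → ℂ), Transforms A B (fun i => φ i)

/-- Some family of linear bijections transforms `A` to `B`. -/
def LinearlyIsomorphic (A : FormRep G n) (B : FormRep G m) : Prop :=
  ∃ φ : ∀ i : Fin t, (Fin (n i) → ℂ) ≃ₗ[ℂ] (Fin (m i) → ℂ), Transforms A B (fun i => φ i)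

end FormRep

/-!
Linear bijections between the spaces `ℂ^n` are homeomorphisms, so only one direction has content.

Let bijections `φ i` transform `A` to `B`, and let the radical at a vertex consist of the vectors
annihilated by all the forms at this vertex. Surjectivity of the `φ i` forces
`φ i (c • x + y) - (c • φ i x + φ i y)` into the radical of `B`
(`FormRep.Transforms.add_smul_sub_mem_radical`), so that `φ i` induces a linear bijection of the
quotients by the radicals (`FormRep.Transforms.quotientEquiv`); continuity plays no role here. Such
a bijection lifts to a linear bijection `ℂ^(n i) → ℂ^(m i)` as soon as `n i = m i`
(`Submodule.exists_linearEquiv_mkQ_eq`), and since the forms factor through the quotients, the lifts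
still transform `A` to `B` (`FormRep.Transforms.of_mkQ_eq`).

Topology enters only through the equality `n i = m i`, which is invariance of dimension
(`Homeomorph.eq_of_pi_complex`). It is deduced from a form of Brouwer's fixed point theorem
(`exists_zero_of_continuous`) and the fact that a smooth map to a space of larger dimension has
range with dense complement. Brouwer's theorem reduces to the smooth no-retraction theorem
(`not_contDiff_retraction`): for a retraction `r` of the unit ball `𝔹` to its boundary, the integral
`∫ x in 𝔹, det ((1 - t) • 1 + t • Dr(x))` is a polynomial in `t`. It equals the volume of the ball
for small `t > 0`, when `(1 - t) • id + t • r` permutes the ball, and vanishes at `t = 1`, because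
`r` has values in the sphere.
-/

/-! ### Polynomial dependence of determinants and interpolation -/

theorem LinearMap.exists_polynomial_eval_eq_det_one_add_smul {E : Type*} [AddCommGroup E]
    [Module ℝ E] [FiniteDimensional ℝ E] (A : E →ₗ[ℝ] E) :
    ∃ p : Polynomial ℝ, p.natDegree ≤ Module.finrank ℝ E ∧
      ∀ t : ℝ, p.eval t = LinearMap.det (1 + t • A) := by
  classical
  let b := Module.finBasis ℝ E
  refine ⟨Matrix.det ((Polynomial.X : Polynomial ℝ) •
    (LinearMap.toMatrix b b A).map Polynomial.C + (1 : Matrix _ _ ℝ).map Polynomial.C), ?_, ?_⟩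
  · simpa using Polynomial.natDegree_det_X_add_C_le (LinearMap.toMatrix b b A) 1
  · intro t
    rw [← LinearMap.det_toMatrix b, ← Polynomial.coe_evalRingHom, RingHom.map_det,
      map_add (LinearMap.toMatrix b b), map_smul (LinearMap.toMatrix b b), LinearMap.toMatrix_one]
    congr 1
    ext i j
    by_cases hij : i = j <;> simp [hij, add_comm, mul_comm t]

theorem Polynomial.eval_eq_sum_lagrange_basis (s : Finset ℝ) (p : Polynomial ℝ)
    (hp : p.natDegree < s.card) (t : ℝ) :
    p.eval t = ∑ i ∈ s, p.eval i * (Lagrange.basis s id i).eval t := by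
  have h := Lagrange.eq_interpolate (s := s) (v := id) (f := p) Function.injective_id.injOn
    (lt_of_le_of_lt Polynomial.degree_le_natDegree (by exact_mod_cast hp))
  conv_lhs => rw [h]
  simp [Lagrange.interpolate_apply, Polynomial.eval_finsetSum]

/-! ### The smooth no-retraction theorem -/

section Topological

open Metric Set MeasureTheory Topology

variable {E : Type*} [NormedAddCommGroup E] [InnerProductSpace ℝ E] [FiniteDimensional ℝ E]

/-- A map of the open unit ball into itself that is close to a linear isomorphism and fixes the
unit sphere is onto: its image is open, and also closed in the ball, because a limit point of the
image comes from the closed ball and boundary points stay on the boundary. -/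
theorem image_ball_eq_ball {f : E → E} {f' : E ≃L[ℝ] E} {c : NNReal}
    (hf : ApproximatesLinearOn f (f' : E →L[ℝ] E) (ball 0 1) c)
    (hc : c < ‖(f'.symm : E →L[ℝ] E)‖₊⁻¹) (hcont : ContinuousOn f (closedBall 0 1))
    (hmaps : MapsTo f (ball 0 1) (ball 0 1)) (hs : ∀ x ∈ sphere (0 : E) 1, f x = x) :
    f '' ball 0 1 = ball 0 1 := by
  refine Subset.antisymm hmaps.image_subset ?_
  refine (convex_ball (0 : E) 1).isPreconnected.subset_of_closure_inter_subset
    (hf.toOpenPartialHomeomorph f _ (Or.inr hc) isOpen_ball).open_target ?_ ?_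
  · exact ⟨f 0, hmaps (by simp), mem_image_of_mem _ (by simp)⟩
  · rintro y ⟨hy, hyb⟩
    have hcl : IsClosed (f '' closedBall 0 1) :=
      ((isCompact_closedBall (0 : E) 1).image_of_continuousOn hcont).isClosed
    obtain ⟨x, hx, rfl⟩ := closure_minimal (image_mono ball_subset_closedBall) hcl hy
    rcases (mem_closedBall_zero_iff.1 hx).lt_or_eq with h | h
    · exact mem_image_of_mem _ (by simpa using h)
    · rw [hs x (by simpa using h)] at hyb
      exact absurd (by simpa using hyb) h.not_lt

/-- There is no `C¹` map to the unit sphere that fixes the unit sphere pointwise (the no-retraction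
theorem, by the volume argument of Milnor and Rogers). -/
theorem not_contDiff_retraction (r : E → E) (hr : ContDiff ℝ 1 r) (hn : ∀ x, ‖r x‖ = 1)
    (hs : ∀ x ∈ sphere (0 : E) 1, r x = x) : False := by
  let _ : MeasurableSpace E := borel E
  have _ : BorelSpace E := ⟨rfl⟩
  have : Nontrivial E := ⟨r 0, 0, norm_pos_iff.1 (by simp [hn])⟩
  set g : E → E := fun x => r x - x with hg
  have hgC : ContDiff ℝ 1 g := hr.sub contDiff_id
  have hgd : Differentiable ℝ g := hgC.differentiable one_ne_zero
  obtain ⟨K, hK⟩ := (hgC.contDiffOn (s := closedBall (0 : E) 1)).exists_lipschitzOnWith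
    one_ne_zero (convex_closedBall _ _) (isCompact_closedBall _ _)
  obtain ⟨M, hM⟩ := (isCompact_closedBall (0 : E) 1).exists_bound_of_continuousOn
    (hgC.continuous_fderiv one_ne_zero).continuousOn
  have hcontdet : Continuous fun A : E →L[ℝ] E => A.det := ContinuousLinearMap.continuous_det
  obtain ⟨δ, hδ, hdet⟩ : ∃ δ > 0, ∀ A ∈ ball (1 : E →L[ℝ] E) δ, 0 < A.det :=
    Metric.mem_nhds_iff.1 (hcontdet.continuousAt.eventually
      (lt_mem_nhds (by simp [ContinuousLinearMap.det])))
  set N := ‖((ContinuousLinearEquiv.refl ℝ E).symm : E →L[ℝ] E)‖₊⁻¹ with hN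
  have hNpos : 0 < N := by simp [hN]
  obtain ⟨ε, hε, hsmall⟩ : ∃ ε > 0, ∀ t ∈ Ioo (0 : ℝ) ε,
      t < 1 ∧ t.toNNReal * K < N ∧ t * M < δ := by
    have h1 : ∀ᶠ t : ℝ in 𝓝 0, t < 1 ∧ t.toNNReal * K < N ∧ t * M < δ := by
      refine (eventually_lt_nhds one_pos).and (Filter.Eventually.and ?_ ?_)
      · have : Continuous fun t : ℝ => t.toNNReal * K := by fun_prop
        exact this.continuousAt.eventually (gt_mem_nhds (by simpa using hNpos))
      · have : Continuous fun t : ℝ => t * M := by fun_prop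
        exact this.continuousAt.eventually (gt_mem_nhds (by simpa using hδ))
    obtain ⟨ε, hε, h⟩ := Metric.eventually_nhds_iff.1 h1
    exact ⟨ε, hε, fun t ht => h (by simpa [abs_of_pos ht.1] using ht.2)⟩
  -- `D t x` is the derivative at `x` of `y ↦ y + t • g y`, the segment from the identity to `r`.
  let D : ℝ → E → E →L[ℝ] E := fun t x => 1 + t • fderiv ℝ g x
  have hDcont : ∀ t, Continuous fun x => (D t x).det := fun t =>
    hcontdet.comp (continuous_const.add ((hgC.continuous_fderiv one_ne_zero).const_smul t))
  have hint : ∀ t, IntegrableOn (fun x => (D t x).det) (ball (0 : E) 1) := fun t =>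
    ((hDcont t).continuousOn.integrableOn_compact (isCompact_closedBall 0 1)).mono_set
      ball_subset_closedBall
  set V : ℝ := volume.real (ball (0 : E) 1) with hV
  have hVpos : 0 < V := by
    refine ENNReal.toReal_pos (measure_ball_pos _ _ one_pos).ne' measure_ball_lt_top.ne
  -- For small `t` the map `y ↦ y + t • g y` permutes the ball and preserves orientation.
  have hvol : ∀ t ∈ Ioo (0 : ℝ) ε, ∫ x in ball (0 : E) 1, (D t x).det = V := by
    intro t ht
    obtain ⟨ht1, htK, htM⟩ := hsmall t ht
    set f : E → E := fun x => x + t • g x with hf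
    have hfd : ∀ x, HasFDerivAt f (D t x) x := fun x =>
      (hasFDerivAt_id x).add ((hgd x).hasFDerivAt.const_smul t)
    have happ : ApproximatesLinearOn f ((ContinuousLinearEquiv.refl ℝ E : E ≃L[ℝ] E) : E →L[ℝ] E)
        (ball 0 1) (t.toNNReal * K) := by
      refine LipschitzOnWith.approximatesLinearOn ?_
      refine LipschitzOnWith.of_dist_le_mul fun x hx y hy => ?_
      have := hK.dist_le_mul x (ball_subset_closedBall hx) y (ball_subset_closedBall hy)
      simp only [hf, Pi.sub_apply, ContinuousLinearEquiv.coe_coe, ContinuousLinearEquiv.refl_apply,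
        add_sub_cancel_left, dist_smul₀, Real.norm_of_nonneg ht.1.le, NNReal.coe_mul,
        Real.coe_toNNReal _ ht.1.le, mul_assoc]
      exact mul_le_mul_of_nonneg_left this ht.1.le
    have himg : f '' ball 0 1 = ball 0 1 := by
      refine image_ball_eq_ball happ htK ?_ ?_ ?_
      · exact (continuous_id.add (hgC.continuous.const_smul t)).continuousOn
      · intro x hx
        rw [mem_ball_zero_iff] at hx ⊢
        have : f x = (1 - t) • x + t • r x := by simp only [hf, hg]; module
        rw [this]
        calc _ ≤ (1 - t) * ‖x‖ + t * ‖r x‖ := by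
              refine (norm_add_le _ _).trans_eq ?_
              rw [norm_smul, norm_smul, Real.norm_of_nonneg ht.1.le,
                Real.norm_of_nonneg (sub_nonneg.2 ht1.le)]
          _ < 1 := by rw [hn]; nlinarith
      · intro x hx
        simp [hf, hg, hs x hx]
    have hch := integral_image_eq_integral_abs_det_fderiv_smul volume measurableSet_ball
      (fun x _ => (hfd x).hasFDerivWithinAt) (happ.injOn (Or.inr htK)) (fun _ => (1 : ℝ))
    rw [himg] at hch
    simp only [integral_const, smul_eq_mul, mul_one, measureReal_restrict_apply_univ] at hch
    rw [hV, hch]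
    refine setIntegral_congr_fun measurableSet_ball fun x hx => ?_
    refine (abs_of_pos (hdet _ ?_)).symm
    rw [mem_ball, dist_eq_norm, add_sub_cancel_left, norm_smul, Real.norm_of_nonneg ht.1.le]
    exact lt_of_le_of_lt (mul_le_mul_of_nonneg_left (hM x (ball_subset_closedBall hx)) ht.1.le) htM
  -- The image of `r` lies in the sphere, so `r x` is not in the range of the derivative at `x`.
  have hzero : ∀ x, (D 1 x).det = 0 := by
    intro x
    have hrd : HasFDerivAt r (D 1 x) x := by
      have := (hasFDerivAt_id x).add (hgd x).hasFDerivAt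
      convert this using 1
      · ext y; simp [hg]
      · simp [D, ContinuousLinearMap.one_def]
    by_contra hne
    have hsurj : Function.Surjective (D 1 x) := by
      have : IsUnit (LinearMap.det (D 1 x : E →ₗ[ℝ] E)) := isUnit_iff_ne_zero.2 hne
      exact ((Module.End.isUnit_iff _).1 ((LinearMap.isUnit_iff_isUnit_det _).2 this)).2
    obtain ⟨v, hv⟩ := hsurj (r x)
    have h1 : HasFDerivAt (fun x => inner ℝ (r x) (r x)) _ x := hrd.inner ℝ hrd
    have h2 : (fun x => inner ℝ (r x) (r x)) = fun _ : E => (1 : ℝ) := by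
      ext y; simp [hn]
    rw [h2] at h1
    have h3 := congrArg (fun A => A v) (h1.unique (hasFDerivAt_const (1 : ℝ) x))
    simp [hv, hn, fderivInnerCLM_apply] at h3
  -- `t ↦ det (D t x)` is a polynomial of degree at most `dim E`: interpolating it at `dim E + 1`
  -- small nodes expresses its value at `t = 1` by values whose integrals are known.
  obtain ⟨s, hsub, hcard⟩ := (Ioo_infinite hε).exists_subset_card_eq (Module.finrank ℝ E + 1)
  have hlag : ∀ x, (D 1 x).det = ∑ i ∈ s, (D i x).det * (Lagrange.basis s id i).eval 1 := by
    intro x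
    obtain ⟨p, hp, hpe⟩ := LinearMap.exists_polynomial_eval_eq_det_one_add_smul
      (fderiv ℝ g x : E →ₗ[ℝ] E)
    have hD : ∀ t, (D t x).det = p.eval t := fun t => (hpe t).symm
    simp only [hD]
    exact Polynomial.eval_eq_sum_lagrange_basis s p (by omega) 1
  have hsum : ∑ i ∈ s, (Lagrange.basis s id i).eval (1 : ℝ) = 1 := by
    rw [← Polynomial.eval_finsetSum, Lagrange.sum_basis Function.injective_id.injOn
      (Finset.card_pos.1 (by omega)), Polynomial.eval_one]
  have hfin : (0 : ℝ) = V := by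
    calc (0 : ℝ) = ∫ x in ball (0 : E) 1, (D 1 x).det := by simp [hzero]
      _ = ∑ i ∈ s, ∫ x in ball (0 : E) 1, (D i x).det * (Lagrange.basis s id i).eval 1 := by
        simp only [hlag]
        exact integral_finsetSum _ fun i _ => (hint i).mul_const _
      _ = V := by
        rw [Finset.sum_congr rfl fun i hi => by rw [integral_mul_const, hvol i (hsub hi)],
          ← Finset.mul_sum, hsum, mul_one]
  exact hVpos.ne hfin

/-! ### Brouwer's theorem and invariance of dimension -/

/-- A form of Brouwer's theorem: a `C¹` map that stays close to the identity has a zero. A bump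
function turns a zero-free `H` into a zero-free `F` that agrees with the identity on the unit
sphere, and then `F / ‖F‖` would be a retraction. -/
theorem exists_zero_of_contDiff (H : E → E) (hH : ContDiff ℝ 1 H)
    (hd : ∀ x, ‖H x - x‖ ≤ 1 / 4) : ∃ x, H x = 0 := by
  by_contra! hne
  let χ : ContDiffBump (0 : E) := ⟨1 / 2, 1, by norm_num, by norm_num⟩
  have hχ : ContDiff ℝ 1 χ := χ.contDiff
  set F : E → E := fun x => x + χ x • (H x - x) with hF
  have hFC : ContDiff ℝ 1 F := contDiff_id.add (hχ.smul (hH.sub contDiff_id))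
  have hF0 : ∀ x, F x ≠ 0 := by
    intro x hx
    rcases le_or_gt ‖x‖ (1 / 2) with h | h
    · have h1 : χ x = 1 := χ.one_of_mem_closedBall (mem_closedBall_zero_iff.2 h)
      exact hne x (by simpa [hF, h1] using hx)
    · have h1 : x = -(χ x • (H x - x)) := eq_neg_of_add_eq_zero_left hx
      have h2 : ‖x‖ ≤ 1 * (1 / 4) := by
        conv_lhs => rw [h1, norm_neg, norm_smul, Real.norm_of_nonneg χ.nonneg]
        exact mul_le_mul χ.le_one (hd x) (norm_nonneg _) zero_le_one
      linarith
  refine not_contDiff_retraction (fun x => ‖F x‖⁻¹ • F x) ?_ ?_ ?_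
  · exact ((hFC.norm ℝ hF0).inv fun x => norm_ne_zero_iff.2 (hF0 x)).smul hFC
  · intro x
    exact norm_smul_inv_norm (𝕜 := ℝ) (hF0 x)
  · intro x hx
    have h1 : χ x = 0 := χ.zero_of_le_dist (by simpa using (mem_sphere_zero_iff_norm.1 hx).ge)
    simp [hF, h1, mem_sphere_zero_iff_norm.1 hx]

theorem exists_zero_of_continuous (H : E → E) (hH : Continuous H)
    (hd : ∀ x, ‖H x - x‖ ≤ 1 / 8) : ∃ x, H x = 0 := by
  by_contra! hne
  -- The error is also kept below `‖H x‖`, so that the smooth approximation has no zero either.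
  obtain ⟨H', hC, hclose, -⟩ := hH.exists_contDiff_approx 1
    (ε := fun x => min (1 / 8) ‖H x‖) (by fun_prop)
    (fun x => lt_min (by norm_num) (norm_pos_iff.2 (hne x)))
  obtain ⟨x, hx⟩ := exists_zero_of_contDiff H' (by exact_mod_cast hC) fun x => by
    have h1 := (hclose x).trans_le (min_le_left _ _)
    rw [dist_eq_norm] at h1
    calc ‖H' x - x‖ = ‖(H' x - H x) + (H x - x)‖ := by congr 1; abel
      _ ≤ 1 / 4 := (norm_add_le _ _).trans (by linarith [hd x])
  have := (hclose x).trans_le (min_le_right _ _)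
  simp [hx] at this

/-- Invariance of dimension. If `dim F < dim E`, the inverse of `e` is approximated by a smooth map
`P : F → E`, whose range has dense complement; choosing a small `c` outside this range, the map
`x ↦ P (e x) - c` is close to the identity but has no zero. -/
theorem Homeomorph.finrank_le {F : Type*} [NormedAddCommGroup F] [NormedSpace ℝ F]
    [FiniteDimensional ℝ F] (e : E ≃ₜ F) : Module.finrank ℝ E ≤ Module.finrank ℝ F := by
  by_contra! hlt
  obtain ⟨P, hP, hclose, -⟩ := e.symm.continuous.exists_contDiff_approx 1
    (ε := fun _ => 1 / 16) continuous_const (fun _ => by norm_num)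
  have hP1 : ContDiff ℝ 1 P := by exact_mod_cast hP
  obtain ⟨c, hc, hcd⟩ := (hP1.dense_compl_range_of_finrank_lt_finrank hlt).exists_dist_lt (0 : E)
    (show (0 : ℝ) < 1 / 16 by norm_num)
  obtain ⟨x, hx⟩ := exists_zero_of_continuous (fun x => P (e x) - c)
    ((hP1.continuous.comp e.continuous).sub continuous_const) fun x => by
      have h1 := hclose (e x)
      rw [e.symm_apply_apply, dist_eq_norm] at h1
      rw [dist_zero_left] at hcd
      calc ‖P (e x) - c - x‖ = ‖(P (e x) - x) - c‖ := by congr 1; abel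
        _ ≤ 1 / 8 := (norm_sub_le _ _).trans (by linarith)
  exact hc ⟨e x, sub_eq_zero.1 hx⟩

theorem Homeomorph.eq_of_pi_complex {n m : ℕ} (e : (Fin n → ℂ) ≃ₜ (Fin m → ℂ)) : n = m := by
  have key : ∀ {k l : ℕ}, ((Fin k → ℂ) ≃ₜ (Fin l → ℂ)) → k ≤ l := by
    intro k l f
    let g : EuclideanSpace ℂ (Fin k) ≃ₜ EuclideanSpace ℂ (Fin l) :=
      (EuclideanSpace.equiv (Fin k) ℂ).toHomeomorph.trans
        (f.trans (EuclideanSpace.equiv (Fin l) ℂ).symm.toHomeomorph)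
    let _ : InnerProductSpace ℝ (EuclideanSpace ℂ (Fin k)) := InnerProductSpace.rclikeToReal ℂ _
    have : FiniteDimensional ℝ (EuclideanSpace ℂ (Fin k)) := FiniteDimensional.complexToReal _
    have : FiniteDimensional ℝ (EuclideanSpace ℂ (Fin l)) := FiniteDimensional.complexToReal _
    have h := g.finrank_le
    rw [finrank_real_of_complex, finrank_real_of_complex] at h
    simpa using h
  exact le_antisymm (key e) (key e.symm)

end Topological

/-! ### Lifting isomorphisms of quotients -/

/-- Between spaces of equal dimension, an isomorphism of quotients lifts to an isomorphism: the two
subspaces have equal dimension too, so complements can be matched by `L` and the subspaces by any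
linear bijection. -/
theorem Submodule.exists_linearEquiv_mkQ_eq {K V W : Type*} [Field K] [AddCommGroup V]
    [Module K V] [FiniteDimensional K V] [AddCommGroup W] [Module K W] [FiniteDimensional K W]
    (h : Module.finrank K V = Module.finrank K W) (N : Submodule K V) (N' : Submodule K W)
    (L : (V ⧸ N) ≃ₗ[K] (W ⧸ N')) :
    ∃ θ : V ≃ₗ[K] W, ∀ x, N'.mkQ (θ x) = L (N.mkQ x) := by
  obtain ⟨C, hC⟩ := N.exists_isCompl
  obtain ⟨C', hC'⟩ := N'.exists_isCompl
  have hN : Module.finrank K N = Module.finrank K N' := by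
    have h1 := N.finrank_quotient_add_finrank
    have h2 := N'.finrank_quotient_add_finrank
    have h3 := L.finrank_eq
    omega
  let q : C ≃ₗ[K] C' := (N.quotientEquivOfIsCompl C hC).symm ≪≫ₗ L ≪≫ₗ
    N'.quotientEquivOfIsCompl C' hC'
  have hq : ∀ c : C, N'.mkQ (q c) = L (N.mkQ c) := by
    intro c
    have : (N'.quotientEquivOfIsCompl C' hC').symm (q c) = L (N.mkQ c) := by simp [q]
    simpa using this
  refine ⟨(N.prodEquivOfIsCompl C hC).symm ≪≫ₗ
    (LinearEquiv.prodCongr (LinearEquiv.ofFinrankEq N N' hN) q) ≪≫ₗ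
    N'.prodEquivOfIsCompl C' hC', fun x => ?_⟩
  obtain ⟨⟨a, c⟩, rfl⟩ := (N.prodEquivOfIsCompl C hC).surjective x
  have := hq c
  have ha : N.mkQ a = 0 := by simp
  have ha' : ∀ b : N', N'.mkQ b = 0 := by simp
  rw [LinearEquiv.trans_apply, LinearEquiv.trans_apply, LinearEquiv.symm_apply_apply]
  simp only [LinearEquiv.prodCongr_apply, Submodule.coe_prodEquivOfIsCompl', map_add, ha, ha',
    zero_add, this]

/-! ### The radical of a form representation -/

namespace FormRep

variable {t : ℕ} {G : MixedGraph.{u, v} t} {n m : Fin t → ℕ}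

/-- The radical of a form representation at the vertex `i`: the vectors of `ℂ^(n i)` annihilated by
every form in every argument that belongs to `i`. To avoid transport along equalities of vertices,
`x` is extended by zero to a family of vectors; its component at another vertex is `0` and gives
no condition. -/
def radical (A : FormRep G n) (i : Fin t) : Submodule ℂ (Fin (n i) → ℂ) where
  carrier := {x |
    (∀ α y, A.bil α (Pi.single (M := fun j => Fin (n j) → ℂ) i x (G.ufst α)) y = 0) ∧
    (∀ α y, A.bil α y (Pi.single (M := fun j => Fin (n j) → ℂ) i x (G.usnd α)) = 0) ∧
    (∀ β y, A.sesq β (Pi.single (M := fun j => Fin (n j) → ℂ) i x (G.dsrc β)) y = 0) ∧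
    (∀ β y, A.sesq β y (Pi.single (M := fun j => Fin (n j) → ℂ) i x (G.dtgt β)) = 0)}
  zero_mem' := by simp
  add_mem' := by
    rintro x y ⟨h1, h2, h3, h4⟩ ⟨k1, k2, k3, k4⟩
    simp_all [Pi.single_add]
  smul_mem' := by
    rintro c x ⟨h1, h2, h3, h4⟩
    simp_all [Pi.single_smul]

theorem mem_radical_iff {A : FormRep G n} {i : Fin t} {x : Fin (n i) → ℂ} :
    x ∈ A.radical i ↔
      (∀ α y, A.bil α (Pi.single (M := fun j => Fin (n j) → ℂ) i x (G.ufst α)) y = 0) ∧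
      (∀ α y, A.bil α y (Pi.single (M := fun j => Fin (n j) → ℂ) i x (G.usnd α)) = 0) ∧
      (∀ β y, A.sesq β (Pi.single (M := fun j => Fin (n j) → ℂ) i x (G.dsrc β)) y = 0) ∧
      (∀ β y, A.sesq β y (Pi.single (M := fun j => Fin (n j) → ℂ) i x (G.dtgt β)) = 0) :=
  Iff.rfl

/-- Membership in the radical follows from the annihilation of every vector, at any vertex,
with a property `P`, provided that `P` holds for `x`. -/
theorem mem_radical_of_forall {A : FormRep G n} {i : Fin t} {x : Fin (n i) → ℂ}
    (P : ∀ j, (Fin (n j) → ℂ) → Prop) (hP : P i x)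
    (h1 : ∀ α x, P _ x → ∀ y, A.bil α x y = 0)
    (h2 : ∀ α x, P _ x → ∀ y, A.bil α y x = 0)
    (h3 : ∀ β x, P _ x → ∀ y, A.sesq β x y = 0)
    (h4 : ∀ β x, P _ x → ∀ y, A.sesq β y x = 0) : x ∈ A.radical i := by
  have key : ∀ j, P j (Pi.single (M := fun j => Fin (n j) → ℂ) i x j) ∨
      Pi.single (M := fun j => Fin (n j) → ℂ) i x j = 0 := by
    intro j
    by_cases h : j = i
    · subst h; left; simpa using hP
    · right; simp [h]
  refine mem_radical_iff.2 ⟨fun α y => ?_, fun α y => ?_, fun β y => ?_, fun β y => ?_⟩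
  · rcases key (G.ufst α) with h | h
    · exact h1 _ _ h _
    · simp [h]
  · rcases key (G.usnd α) with h | h
    · exact h2 _ _ h _
    · simp [h]
  · rcases key (G.dsrc β) with h | h
    · exact h3 _ _ h _
    · simp [h]
  · rcases key (G.dtgt β) with h | h
    · exact h4 _ _ h _
    · simp [h]

variable {A : FormRep G n} {B : FormRep G m}

theorem Transforms.symm {φ : ∀ i, (Fin (n i) → ℂ) ≃ (Fin (m i) → ℂ)}
    (h : Transforms A B fun i => φ i) : Transforms B A fun i => (φ i).symm :=
  ⟨fun α x y => by simp [h.1], fun β x y => by simp [h.2]⟩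

/-- Bijections transforming `A` to `B` are linear modulo the radical: every vector at the
other end of an edge is a value of `φ`, so the forms of `B` can be pulled back to those of `A`,
where linearity is available. -/
theorem Transforms.add_smul_sub_mem_radical {φ : ∀ i, (Fin (n i) → ℂ) ≃ (Fin (m i) → ℂ)}
    (h : Transforms A B fun i => φ i) (i : Fin t) (c : ℂ) (x y : Fin (n i) → ℂ) :
    φ i (c • x + y) - (c • φ i x + φ i y) ∈ B.radical i := by
  refine mem_radical_of_forall
    (fun j z => ∃ x y, z = φ j (c • x + y) - (c • φ j x + φ j y)) ⟨x, y, rfl⟩ ?_ ?_ ?_ ?_ <;>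
  · rintro α _ ⟨x, y, rfl⟩ w
    obtain ⟨w, rfl⟩ := (φ _).surjective w
    simp only [map_sub, map_add, LinearMap.sub_apply, LinearMap.add_apply, map_smul,
      LinearMap.smul_apply, map_smulₛₗ, ← h.1, ← h.2, sub_self]

theorem Transforms.sub_mem_radical {φ : ∀ i, (Fin (n i) → ℂ) ≃ (Fin (m i) → ℂ)}
    (h : Transforms A B fun i => φ i) {i : Fin t} {x y : Fin (n i) → ℂ}
    (hxy : x - y ∈ A.radical i) : φ i x - φ i y ∈ B.radical i := by
  refine mem_radical_of_forall
    (fun j z => ∃ x y, x - y ∈ A.radical j ∧ z = φ j x - φ j y) ⟨x, y, hxy, rfl⟩ ?_ ?_ ?_ ?_ <;>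
  · rintro α _ ⟨x, y, hxy, rfl⟩ w
    obtain ⟨w, rfl⟩ := (φ _).surjective w
    obtain ⟨h1, h2, h3, h4⟩ := mem_radical_iff.1 hxy
    simp only [map_sub, LinearMap.sub_apply, ← h.1, ← h.2]
    first
    | simpa using h1 α w
    | simpa using h2 α w
    | simpa using h3 α w
    | simpa using h4 α w

theorem Transforms.apply_zero_mem_radical {φ : ∀ i, (Fin (n i) → ℂ) ≃ (Fin (m i) → ℂ)}
    (h : Transforms A B fun i => φ i) {i : Fin t} : φ i 0 ∈ B.radical i := by
  simpa using h.add_smul_sub_mem_radical i 1 0 0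

/-- The linear map that bijections transforming `A` to `B` induce on the quotients by the radicals. -/
noncomputable def Transforms.quotientMap {φ : ∀ i, (Fin (n i) → ℂ) ≃ (Fin (m i) → ℂ)}
    (h : Transforms A B fun i => φ i) (i : Fin t) :
    ((Fin (n i) → ℂ) ⧸ A.radical i) →ₗ[ℂ] ((Fin (m i) → ℂ) ⧸ B.radical i) where
  toFun := Quotient.map' (φ i) fun x y hxy => by
    rw [Submodule.quotientRel_def] at hxy ⊢
    exact h.sub_mem_radical hxy
  map_add' a b := by
    obtain ⟨x, rfl⟩ := (A.radical i).mkQ_surjective a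
    obtain ⟨y, rfl⟩ := (A.radical i).mkQ_surjective b
    refine (Submodule.Quotient.eq _).2 ?_
    simpa using h.add_smul_sub_mem_radical i 1 x y
  map_smul' c a := by
    obtain ⟨x, rfl⟩ := (A.radical i).mkQ_surjective a
    refine (Submodule.Quotient.eq _).2 ?_
    have := add_mem (h.add_smul_sub_mem_radical i c x 0) h.apply_zero_mem_radical
    rwa [add_zero, ← sub_sub, sub_add_cancel] at this

theorem Transforms.quotientMap_mkQ {φ : ∀ i, (Fin (n i) → ℂ) ≃ (Fin (m i) → ℂ)}
    (h : Transforms A B fun i => φ i) (i : Fin t) (x : Fin (n i) → ℂ) :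
    h.quotientMap i ((A.radical i).mkQ x) = (B.radical i).mkQ (φ i x) := rfl

/-- The linear bijection that bijections transforming `A` to `B` induce on the quotients by the
radicals. -/
noncomputable def Transforms.quotientEquiv {φ : ∀ i, (Fin (n i) → ℂ) ≃ (Fin (m i) → ℂ)}
    (h : Transforms A B fun i => φ i) (i : Fin t) :
    ((Fin (n i) → ℂ) ⧸ A.radical i) ≃ₗ[ℂ] ((Fin (m i) → ℂ) ⧸ B.radical i) :=
  LinearEquiv.ofLinearMap (h.quotientMap i) (h.symm.quotientMap i)
    (Submodule.linearMap_qext _ <| LinearMap.ext fun x => by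
      simp only [LinearMap.comp_apply, quotientMap_mkQ, Equiv.apply_symm_apply, LinearMap.id_apply])
    (Submodule.linearMap_qext _ <| LinearMap.ext fun x => by
      simp only [LinearMap.comp_apply, quotientMap_mkQ, Equiv.symm_apply_apply, LinearMap.id_apply])

/-- The forms do not see the radicals, so they only depend on the maps `φ i` modulo the radicals. -/
theorem Transforms.of_mkQ_eq {φ θ : ∀ i, (Fin (n i) → ℂ) → (Fin (m i) → ℂ)}
    (h : Transforms A B φ) (hθ : ∀ i x, (B.radical i).mkQ (θ i x) = (B.radical i).mkQ (φ i x)) :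
    Transforms A B θ := by
  have hmem : ∀ i x, θ i x - φ i x ∈ B.radical i := fun i x =>
    (Submodule.Quotient.eq _).1 (hθ i x)
  constructor
  · intro α x y
    have h1 := (mem_radical_iff.1 (hmem _ x)).1 α (θ _ y)
    have h2 := (mem_radical_iff.1 (hmem _ y)).2.1 α (φ _ x)
    simp only [Pi.single_eq_same, map_sub, LinearMap.sub_apply, sub_eq_zero] at h1 h2
    rw [h.1, h1, h2]
  · intro β x y
    have h1 := (mem_radical_iff.1 (hmem _ x)).2.2.1 β (θ _ y)
    have h2 := (mem_radical_iff.1 (hmem _ y)).2.2.2 β (φ _ x)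
    simp only [Pi.single_eq_same, map_sub, LinearMap.sub_apply, sub_eq_zero] at h1 h2
    rw [h.2, h1, h2]

end FormRep

theorem theorem1 {t : ℕ} (G : MixedGraph.{u, v} t) (n m : Fin t → ℕ)
    (A : FormRep G n) (B : FormRep G m) :
    FormRep.TopologicallyIsomorphic A B ↔ FormRep.LinearlyIsomorphic A B := by
  constructor
  · rintro ⟨φ, h⟩
    have h' : FormRep.Transforms A B fun i => (φ i).toEquiv := h
    have hdim (i : Fin t) :
        Module.finrank ℂ (Fin (n i) → ℂ) = Module.finrank ℂ (Fin (m i) → ℂ) := by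
      rw [(φ i).eq_of_pi_complex]
    choose θ hθ using fun i =>
      Submodule.exists_linearEquiv_mkQ_eq (hdim i) _ _ (h'.quotientEquiv i)
    exact ⟨θ, h.of_mkQ_eq fun i x => hθ i x⟩
  · rintro ⟨φ, h⟩
    exact ⟨fun i => (φ i).toContinuousLinearEquiv.toHomeomorph, h⟩
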